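/- Let $\lambda$ denote Lebesgue measure. For $S\subseteq\mathbb R^d$ of finite positive measure, let the convexity ratio $c(S)$ be the supremum of the measures of the convex subsets of $S$, divided by $\lambda(S)$. Let $b_d(S)$ be the probability that the convex hull of $d+1$ points chosen independently and uniformly at random from $S$ is contained in $S$, i.e. $$b_d(S)=\frac{\lambda\big(\{(A_0,\dots,A_d)\in S^{d+1}:\operatorname{conv}\{A_0,\dots,A_d\}\subseteq S\}\big)}{\lambda(S)^{d+1}};$$ it is defined when $S$ is measurable with $0<\lambda(S)<\infty$ and the set of tuples in the numerator is measurable. An ellipsoid is the image of the closed unit ball under a nonsingular affine map. **Theorem.** Let $d\ge 2$. (1) There is a constant $\gamma=\gamma(d)>0$ such that for every $\varepsilon\in(0,1]$ there is a set $S\subseteq\mathbb R^d$ with $\lambda(S)=1$, with $b_d(S)$ defined, and with $$c(S)\le\varepsilon,\qquad b_d(S)\ge\gamma\,\frac{\varepsilon}{\max\{1,\log_2(1/\varepsilon)\}},$$ so that $b_d(S)\ge\gamma\,\varepsilon/\log_2(1/\varepsilon)$ whenever $\varepsilon\le 1/2$; moreover $0<c(S)<1$ and $$b_d(S)\ge\gamma\,\frac{c(S)}{\log_2(1/c(S))}.$$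 The set can be taken of the form $S=(0,1)^d\setminus N$, where $N\subseteq(0,1)^d$ is finite and meets every set $E\cap(0,1)^d$, $E$ an ellipsoid, with $\lambda(E\cap(0,1)^d)\ge\varepsilon/d^d$. (2) For every $n\ge1$ and all points $B_1,\dots,B_n\in(0,1)^d$, the set $S=(0,1)^d\setminus\{B_1,\dots,B_n\}$ has $b_d(S)$ defined and $b_d(S)\ge\frac1{2n}$. -/

import Mathlib

open MeasureTheory

noncomputable section

namespace ConvexityIndex

/-- `d`-dimensional Euclidean space; its `volume` is `d`-dimensional Lebesgue measure. -/
abbrev Space (d : ℕ) : Type := EuclideanSpace ℝ (Fin d)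

/-- The `k`-simplex set of `S`: all `(k+1)`-tuples of points of `S` whose convex hull
is contained in `S`. -/
def simplexSet {d : ℕ} (k : ℕ) (S : Set (Space d)) : Set (Fin (k + 1) → Space d) :=
  {A | (∀ i, A i ∈ S) ∧ convexHull ℝ (Set.range A) ⊆ S}

/-- The supremum of the Lebesgue measures of the convex subsets of `S`. -/
def supConvex {d : ℕ} (S : Set (Space d)) : ENNReal :=
  sSup {m | ∃ K : Set (Space d), K ⊆ S ∧ Convex ℝ K ∧ m = volume K}

/-- The convexity ratio `c(S)`, meaningful when `S` has finite positive measure. -/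
def convexityRatio {d : ℕ} (S : Set (Space d)) : ℝ :=
  (supConvex S / volume S).toReal

/-- The condition under which the `k`-index of convexity of `S` is defined: `S` and its
`k`-simplex set are Lebesgue measurable, and `S` has finite positive measure. -/
structure KIndexDefined {d : ℕ} (k : ℕ) (S : Set (Space d)) : Prop where
  measurable : NullMeasurableSet S volume
  pos : 0 < volume S
  finite : volume S < ⊤
  simplexSet_measurable : NullMeasurableSet (simplexSet k S) volume

/-- The `k`-index of convexity `b_k(S)`, meaningful under `KIndexDefined k S`. -/
def kIndex {d : ℕ} (k : ℕ) (S : Set (Space d)) : ℝ :=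
  (volume (simplexSet k S) / volume S ^ (k + 1)).toReal

/-- The open box `(0,1)^d`. -/
def openCube (d : ℕ) : Set (Space d) :=
  {x | ∀ i, 0 < x i ∧ x i < 1}

/-- A `d`-dimensional ellipsoid: the image of the closed unit ball under a nonsingular
affine map. -/
def IsEllipsoid {d : ℕ} (E : Set (Space d)) : Prop :=
  ∃ f : Space d ≃ᵃ[ℝ] Space d, E = f '' Metric.closedBall 0 1

/-- The restriction to `X` of the system of all ellipsoids: the sets `E ∩ X`. -/
def ellipsoidsIn {d : ℕ} (X : Set (Space d)) : Set (Set (Space d)) :=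
  {U | ∃ E, IsEllipsoid E ∧ U = E ∩ X}

/-- `N` is a `δ`-net for the set system `𝒰` on `X`: `N ⊆ X` meets every member of `𝒰` of
measure at least `δ`. -/
def IsNet {d : ℕ} (δ : ℝ) (X : Set (Space d)) (𝒰 : Set (Set (Space d)))
    (N : Set (Space d)) : Prop :=
  N ⊆ X ∧ ∀ U ∈ 𝒰, ENNReal.ofReal δ ≤ volume U → (N ∩ U).Nonempty

end ConvexityIndex

end

open MeasureTheory

noncomputable section

namespace ConvexityIndex

/-! ### Convex hulls of finite tuples -/

/-! Part (2). Fix `d - 1` of the random points in general position. They span a flat of codimension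
2, and projecting along it sends the flat to the origin of a plane and each `Bᵢ` to a nonzero
vector. The `n` lines through the origin and these vectors leave at most `2n` sectors
(`exists_card_signPattern_le`). If the two remaining points project into the same open sector, they
lie strictly on one side of the hyperplane through the flat and `Bᵢ`, for every `i`, so the simplex
misses every `Bᵢ` (`notMem_convexHull_of_side`). Two independent points share one of at most `2n`
classes with probability at least `1/(2n)`, by Cauchy–Schwarz
(`one_div_le_lintegral_measure_fiber`); Fubini finishes.

Part (1). By (2) it suffices to hit all convex subsets of the cube of volume at least `ε` with
`O(ε⁻¹ log(1/ε))` points. Convex sets form a system of infinite VC dimension, but each such set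
contains a simplex of volume at least a constant times `ε` whose vertices lie on a grid of mesh
comparable to `ε` (`exists_grid_simplex`). There are only polynomially many grid simplices in `1/ε`,
so greedy choice hits all the large ones with logarithmic overhead (`exists_finset_hitting`).
Ellipsoids cut with the cube are convex, so they are hit as well. -/

theorem mem_convexHull_range_iff {E ι : Type*} [AddCommGroup E] [Module ℝ E] [Fintype ι]
    (A : ι → E) (b : E) :
    b ∈ convexHull ℝ (Set.range A) ↔ ∃ w ∈ stdSimplex ℝ ι, ∑ i, w i • A i = b := by
  constructor
  · intro hb
    refine convexHull_min (t := {b | ∃ w ∈ stdSimplex ℝ ι, ∑ i, w i • A i = b}) ?_ ?_ hb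
    · classical
      rintro _ ⟨i, rfl⟩
      refine ⟨Pi.single i 1, single_mem_stdSimplex ℝ i, ?_⟩
      simp [Pi.single_apply]
    · rintro _ ⟨w, hw, rfl⟩ _ ⟨w', hw', rfl⟩ s t hs ht hst
      refine ⟨s • w + t • w', convex_stdSimplex ℝ ι hw hw' hs ht hst, ?_⟩
      simp [add_smul, mul_smul, Finset.sum_add_distrib, Finset.smul_sum]
  · rintro ⟨w, hw, rfl⟩
    exact mem_convexHull_of_exists_fintype w A hw.1 hw.2 (fun i => ⟨i, rfl⟩) rfl

/-- The set is the projection of a closed set of pairs (weights, tuple) along the compact simplex of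
weights, and such a projection is a closed map. This gives measurability of the simplex sets. -/
theorem isClosed_setOf_mem_convexHull_range {E ι : Type*} [NormedAddCommGroup E]
    [NormedSpace ℝ E] [Fintype ι] (b : E) :
    IsClosed {A : ι → E | b ∈ convexHull ℝ (Set.range A)} := by
  have : CompactSpace (stdSimplex ℝ ι) :=
    isCompact_iff_compactSpace.1 (isCompact_stdSimplex ℝ ι)
  have hc : IsClosed {z : stdSimplex ℝ ι × (ι → E) | ∑ i, (z.1 : ι → ℝ) i • z.2 i = b} := by
    refine isClosed_eq (continuous_finsetSum _ fun i _ => ?_) continuous_const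
    exact (((continuous_apply i).comp continuous_subtype_val).comp continuous_fst).smul
      ((continuous_apply i).comp continuous_snd)
  convert! isClosedMap_snd_of_compactSpace _ hc using 1
  ext A
  simp only [mem_convexHull_range_iff, Set.mem_ofPred_eq, Set.mem_image, Prod.exists,
    exists_eq_right, Subtype.exists]
  exact ⟨fun ⟨w, hw, h⟩ => ⟨w, hw, h⟩, fun ⟨w, hw, h⟩ => ⟨w, hw, h⟩⟩

/-! ### Generic tuples -/

theorem measurableSet_linearIndependent_sub {d k : ℕ} (b : Space d) :
    MeasurableSet {a : Fin k → Space d | LinearIndependent ℝ (fun j => a j - b)} := by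
  have hc : Continuous fun (a : Fin k → Space d) (j : Fin k) => a j - b := by fun_prop
  have ho : IsOpen {a : Fin k → Space d | LinearIndependent ℝ a} :=
    isOpen_setOfPred_linearIndependent
  exact (ho.preimage hc).measurableSet

theorem ae_sub_notMem {E : Type*} [NormedAddCommGroup E] [NormedSpace ℝ E] [MeasurableSpace E]
    [BorelSpace E] [FiniteDimensional ℝ E] (μ : Measure E) [μ.IsAddHaarMeasure]
    (W : Submodule ℝ E) (hW : W ≠ ⊤) (b : E) : ∀ᵐ x ∂μ, x - b ∉ W := by
  have h : μ ((fun x => x - b) ⁻¹' (W : Set E)) = 0 := by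
    rw [(measurePreserving_sub_right μ b).measure_preimage
      W.closed_of_finiteDimensional.measurableSet.nullMeasurableSet]
    exact Measure.addHaar_submodule μ W hW
  exact measure_eq_zero_iff_ae_notMem.1 h

/-- Induction on `k`: given an independent family of `k < d` vectors, the next point only has to
avoid a translate of a proper subspace, which is null. -/
theorem ae_linearIndependent_sub {d : ℕ} (b : Space d) :
    ∀ k ≤ d, ∀ᵐ a : Fin k → Space d, LinearIndependent ℝ (fun j => a j - b) := by
  intro k
  induction k with
  | zero => exact fun _ => Filter.Eventually.of_forall fun a => linearIndependent_empty_type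
  | succ k ih =>
    intro hk
    have hcons : ∀ (x : Space d) (a : Fin k → Space d),
        (fun j => (Fin.cons x a : Fin (k + 1) → Space d) j - b) =
          Fin.cons (x - b) (fun j => a j - b) := by
      intro x a
      ext j : 1
      refine Fin.cases ?_ (fun j => ?_) j <;> simp
    have hmp := (volume_preserving_piFinSuccAbove (fun _ : Fin (k + 1) => Space d) 0).symm
    have hms : MeasurableSet {z : Space d × (Fin k → Space d) |
        LinearIndependent ℝ (fun j => (Fin.cons z.1 z.2 : Fin (k + 1) → Space d) j - b)} := by
      refine (measurableSet_linearIndependent_sub b).preimage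
        (f := fun z : Space d × (Fin k → Space d) => (Fin.cons z.1 z.2 : Fin (k + 1) → Space d)) ?_
      refine measurable_pi_lambda _ fun j => ?_
      refine Fin.cases ?_ (fun j => ?_) j
      · simpa using measurable_fst
      · exact (measurable_pi_apply j).comp measurable_snd
    have key : ∀ᵐ z : Space d × (Fin k → Space d),
        LinearIndependent ℝ (fun j => (Fin.cons z.1 z.2 : Fin (k + 1) → Space d) j - b) := by
      -- The new point is the first coordinate of the product; the order is swapped so that it is
      -- chosen after the others.
      refine (Measure.ae_prod_iff_ae_ae hms).2 ((Measure.ae_ae_comm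
        (p := fun x a => LinearIndependent ℝ
          (fun j => (Fin.cons x a : Fin (k + 1) → Space d) j - b)) hms).2 ?_)
      filter_upwards [ih (by omega)] with a ha
      have hW : Submodule.span ℝ (Set.range fun j => a j - b) ≠ ⊤ := by
        intro h
        have h1 := finrank_span_eq_card ha
        rw [h, finrank_top] at h1
        simp at h1
        omega
      filter_upwards [ae_sub_notMem volume _ hW b] with x hx
      rw [hcons]
      exact linearIndependent_finCons.2 ⟨ha, hx⟩
    have h2 := (volume_preserving_piFinSuccAbove (fun _ : Fin (k + 1) => Space d)
      0).quasiMeasurePreserving.ae key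
    filter_upwards [h2] with a ha
    have : (Fin.cons (a 0) (fun j => a j.succ) : Fin (k + 1) → Space d) = a := Fin.cons_self_tail a
    simpa [MeasurableEquiv.piFinSuccAbove, Fin.insertNthEquiv, Fin.removeNth, this] using ha

/-! ### Sign patterns of lines in the plane -/

/-- The planar cross product. -/
def cross (b x : ℝ × ℝ) : ℝ := b.1 * x.2 - b.2 * x.1

/-- The sides of the lines `ℝ b₀, …, ℝ bₙ₋₁` on which the point `x` lies. -/
def signPattern {n : ℕ} (b : Fin n → ℝ × ℝ) (x : ℝ × ℝ) : Fin n → Bool :=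
  fun i => decide (0 < cross (b i) x)

theorem exists_smul_of_cross_eq_zero {b x : ℝ × ℝ} (hb : b ≠ 0) (h : cross b x = 0) :
    ∃ c : ℝ, x = c • b := by
  obtain ⟨b1, b2⟩ := b
  obtain ⟨x1, x2⟩ := x
  simp only [cross] at h
  by_cases h1 : b1 = 0
  · have h2 : b2 ≠ 0 := by
      rintro rfl
      exact hb (by simp [h1])
    refine ⟨x2 / b2, ?_⟩
    subst h1
    ext <;> simp_all
  · refine ⟨x1 / b1, ?_⟩
    ext
    · simp [h1]
    · simp
      field_simp
      linarith

/-- Each added line contributes at most two patterns: a sector met on both sides by the new line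
contains one of its two rays from the origin, so its old pattern is that of `b 0` or of `-b 0`. -/
theorem exists_card_signPattern_le {n : ℕ} (hn : 1 ≤ n) (b : Fin n → ℝ × ℝ)
    (hb : ∀ i, b i ≠ 0) :
    ∃ P : Finset (Fin n → Bool), P.card ≤ 2 * n ∧
      ∀ x, (∀ i, cross (b i) x ≠ 0) → signPattern b x ∈ P := by
  classical
  induction n, hn using Nat.le_induction with
  | base => exact ⟨Finset.univ, by simp, fun x _ => Finset.mem_univ _⟩
  | succ n hn ih =>
    obtain ⟨P, hPc, hP⟩ := ih (fun i => b i.succ) (fun i => hb i.succ)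
    set b' : Fin n → ℝ × ℝ := fun i => b i.succ
    -- `C σ` says that `σ` occurs on the positive side of the new line. Each old pattern is extended
    -- once, by the truth value of `C`; the opposite extension is needed only for patterns that
    -- occur on both sides.
    set C : (Fin n → Bool) → Prop := fun σ => ∃ x, (∀ i, cross (b i) x ≠ 0) ∧
      signPattern b' x = σ ∧ 0 < cross (b 0) x
    have hpat : ∀ x, signPattern b x =
        Fin.cons (decide (0 < cross (b 0) x)) (signPattern b' x) := by
      intro x
      ext j
      refine Fin.cases ?_ (fun j => ?_) j <;> simp [signPattern, b']
    refine ⟨P.image (fun σ => Fin.cons (decide (C σ)) σ) ∪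
      ({signPattern b' (b 0), signPattern b' (-b 0)} : Finset _).image
        (fun σ => Fin.cons (!decide (C σ)) σ), ?_, ?_⟩
    · refine (Finset.card_union_le _ _).trans ?_
      have h1 := Finset.card_image_le (s := P)
        (f := fun σ => (Fin.cons (decide (C σ)) σ : Fin (n + 1) → Bool))
      have h2 := Finset.card_image_le
        (s := ({signPattern b' (b 0), signPattern b' (-b 0)} : Finset _))
        (f := fun σ => (Fin.cons (!decide (C σ)) σ : Fin (n + 1) → Bool))
      have h3 := Finset.card_le_two (a := signPattern b' (b 0)) (b := signPattern b' (-b 0))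
      omega
    · intro x hx
      rw [hpat]
      by_cases hc : decide (0 < cross (b 0) x) = decide (C (signPattern b' x))
      · refine Finset.mem_union_left _ (Finset.mem_image.2 ⟨_, hP x fun i => hx i.succ, ?_⟩)
        rw [hc]
      · refine Finset.mem_union_right _ (Finset.mem_image.2 ⟨signPattern b' x, ?_, ?_⟩)
        · have hneg : ¬ 0 < cross (b 0) x := fun h0 => hc (by simp [h0, show C _ from ⟨x, hx, rfl, h0⟩])
          have hC : C (signPattern b' x) := by
            by_contra h
            simp [h, hneg] at hc
          obtain ⟨y, hy, hyx, hy0⟩ := hC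
          have hx0 : cross (b 0) x < 0 := lt_of_le_of_ne (not_lt.1 hneg) (hx 0)
          -- A positive combination of `x` and `y`, weighted to lie on the new line; it keeps the
          -- old pattern shared by `x` and `y`.
          set z := cross (b 0) y • x + (-cross (b 0) x) • y with hz
          have hcz : ∀ i, cross (b i) z =
              cross (b 0) y * cross (b i) x + (-cross (b 0) x) * cross (b i) y := by
            intro i
            simp only [hz, cross, Prod.fst_add, Prod.snd_add, Prod.smul_fst, Prod.smul_snd,
              smul_eq_mul]
            ring
          obtain ⟨c, hcb⟩ := exists_smul_of_cross_eq_zero (hb 0) (x := z) (by rw [hcz]; ring)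
          have hpos : ∀ i : Fin n, (0 < cross (b i.succ) x ↔ 0 < cross (b i.succ) y) := by
            intro i
            have := congrFun hyx i
            simpa [signPattern, b', eq_comm] using this
          have hzx : ∀ i : Fin n, cross (b i.succ) z ≠ 0 ∧
              (0 < cross (b i.succ) z ↔ 0 < cross (b i.succ) x) := by
            intro i
            rw [hcz]
            rcases lt_or_gt_of_ne (hx i.succ) with h | h
            · have h' : cross (b i.succ) y < 0 :=
                lt_of_le_of_ne (not_lt.1 fun h'' => h.not_gt ((hpos i).2 h'')) (hy i.succ)
              have : cross (b 0) y * cross (b i.succ) x + (-cross (b 0) x) * cross (b i.succ) y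
                  < 0 := by
                have := mul_neg_of_pos_of_neg hy0 h
                have := mul_neg_of_pos_of_neg (neg_pos.2 hx0) h'
                linarith
              exact ⟨this.ne, by constructor <;> intro <;> linarith⟩
            · have h' := (hpos i).1 h
              have : 0 < cross (b 0) y * cross (b i.succ) x +
                  (-cross (b 0) x) * cross (b i.succ) y := by
                have := mul_pos hy0 h
                have := mul_pos (neg_pos.2 hx0) h'
                linarith
              exact ⟨this.ne', by constructor <;> intro <;> assumption⟩
          have hcm : ∀ i, cross (b i) z = c * cross (b i) (b 0) := by
            intro i
            rw [hcb]
            simp only [cross, Prod.smul_fst, Prod.smul_snd, smul_eq_mul]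
            ring
          have hcn : ∀ i, cross (b i) (-b 0) = - cross (b i) (b 0) := by
            intro i
            simp only [cross, Prod.fst_neg, Prod.snd_neg]
            ring
          -- At the origin every cross product vanishes, whereas `z` lies off the old lines, of
          -- which there is at least one.
          have hc0 : c ≠ 0 := by
            rintro rfl
            have := (hzx ⟨0, hn⟩).1
            rw [hcm] at this
            simp at this
          rw [Finset.mem_insert, Finset.mem_singleton]
          rcases lt_or_gt_of_ne hc0 with h | h
          · right
            ext i
            simp only [signPattern, b', ← (hzx i).2, hcm, hcn, decide_eq_decide]
            constructor <;> intro <;> nlinarith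
          · left
            ext i
            simp only [signPattern, b', ← (hzx i).2, hcm, decide_eq_decide]
            exact mul_pos_iff_of_pos_left h
        · congr 1
          revert hc
          generalize decide (0 < cross (b 0) x) = p
          generalize decide (C (signPattern b' x)) = q
          revert p q
          decide

/-! ### The open cube -/

theorem openCube_eq_preimage (d : ℕ) : openCube d =
    (MeasurableEquiv.toLp 2 (Fin d → ℝ)).symm ⁻¹' (Set.univ.pi fun _ => Set.Ioo (0 : ℝ) 1) := by
  ext x
  simp only [openCube, Set.mem_ofPred_eq, Set.mem_preimage, Set.mem_pi, Set.mem_univ,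
    true_imp_iff, Set.mem_Ioo]
  rfl

theorem isOpen_openCube (d : ℕ) : IsOpen (openCube d) := by
  have : openCube d = ⋂ i, {x : Space d | 0 < x i ∧ x i < 1} := by
    ext x
    simp [openCube]
  rw [this]
  refine isOpen_iInter_of_finite fun i => ?_
  have hc : Continuous fun x : Space d => x i := by fun_prop
  exact (isOpen_lt continuous_const hc).inter (isOpen_lt hc continuous_const)

theorem convex_openCube (d : ℕ) : Convex ℝ (openCube d) := by
  have : openCube d = ⋂ i, {x : Space d | 0 < x i ∧ x i < 1} := by
    ext x
    simp [openCube]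
  rw [this]
  refine convex_iInter fun i => ?_
  exact (convex_Ioo (0 : ℝ) 1).linear_preimage (EuclideanSpace.proj i : Space d →L[ℝ] ℝ).toLinearMap

theorem volume_openCube (d : ℕ) : volume (openCube d) = 1 := by
  rw [openCube_eq_preimage, (EuclideanSpace.volume_preserving_symm_measurableEquiv_toLp
    (Fin d)).measure_preimage_equiv, Real.volume_pi_Ioo]
  simp

instance isProbabilityMeasure_restrict_openCube (d : ℕ) :
    IsProbabilityMeasure (volume.restrict (openCube d)) :=
  ⟨by rw [Measure.restrict_apply_univ, volume_openCube]⟩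

theorem simplexSet_openCube_diff {d n : ℕ} (k : ℕ) (B : Fin n → Space d) :
    simplexSet k (openCube d \ Set.range B) =
      (Set.univ.pi fun _ => openCube d) \ ⋃ i, {A | B i ∈ convexHull ℝ (Set.range A)} := by
  ext A
  simp only [simplexSet, Set.mem_ofPred_eq, Set.mem_sdiff, Set.mem_pi, Set.mem_univ, true_imp_iff,
    Set.mem_iUnion, not_exists]
  constructor
  · rintro ⟨h1, h2⟩
    exact ⟨fun i => (h1 i).1, fun i hi => (h2 hi).2 ⟨i, rfl⟩⟩
  · rintro ⟨h1, h2⟩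
    have h3 : convexHull ℝ (Set.range A) ⊆ openCube d \ Set.range B := by
      intro x hx
      refine ⟨convexHull_min (Set.range_subset_iff.2 h1) (convex_openCube d) hx, ?_⟩
      rintro ⟨i, rfl⟩
      exact h2 i hx
    exact ⟨fun i => h3 (subset_convexHull ℝ _ ⟨i, rfl⟩), h3⟩

theorem measurableSet_simplexSet_openCube_diff {d n : ℕ} (k : ℕ) (B : Fin n → Space d) :
    MeasurableSet (simplexSet k (openCube d \ Set.range B)) := by
  rw [simplexSet_openCube_diff]
  refine (MeasurableSet.univ_pi fun _ => (isOpen_openCube d).measurableSet).diff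
    (MeasurableSet.iUnion fun i => ?_)
  exact (isClosed_setOf_mem_convexHull_range (B i)).measurableSet

theorem volume_openCube_diff {d : ℕ} (hd : 1 ≤ d) {N : Set (Space d)} (hN : N.Finite) :
    volume (openCube d \ N) = 1 := by
  have : Nonempty (Fin d) := ⟨⟨0, hd⟩⟩
  rw [measure_sdiff_null (hN.measure_zero volume), volume_openCube]

theorem kIndexDefined_openCube_diff {d n : ℕ} (hd : 1 ≤ d) (k : ℕ) (B : Fin n → Space d) :
    KIndexDefined k (openCube d \ Set.range B) where
  measurable := ((isOpen_openCube d).measurableSet.diff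
    (Set.finite_range B).measurableSet).nullMeasurableSet
  pos := by simp [volume_openCube_diff hd (Set.finite_range B)]
  finite := by simp [volume_openCube_diff hd (Set.finite_range B)]
  simplexSet_measurable := (measurableSet_simplexSet_openCube_diff k B).nullMeasurableSet

/-! ### Collisions of random values -/

/-- The right side is the probability that two independent samples have the same value of `f`, hence
at least the sum of the squared fibre masses over `P`; these masses add up to 1, and Cauchy–Schwarz
applies. -/
theorem one_div_le_lintegral_measure_fiber {X T : Type*} [MeasurableSpace X] (μ : Measure X)
    [IsProbabilityMeasure μ] (f : X → T) (hf : ∀ t, MeasurableSet (f ⁻¹' {t})) (P : Finset T)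
    {k : ℕ} (hP : P.card ≤ k) (hfP : ∀ᵐ x ∂μ, f x ∈ P) :
    ENNReal.ofReal (1 / k) ≤ ∫⁻ y, μ (f ⁻¹' {f y}) ∂μ := by
  classical
  have h1 : ∑ t ∈ P, μ (f ⁻¹' {t}) * μ (f ⁻¹' {t}) ≤ ∫⁻ y, μ (f ⁻¹' {f y}) ∂μ := by
    calc ∑ t ∈ P, μ (f ⁻¹' {t}) * μ (f ⁻¹' {t})
        = ∫⁻ y, ∑ t ∈ P, (f ⁻¹' {t}).indicator (fun _ => μ (f ⁻¹' {t})) y ∂μ := by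
          rw [lintegral_finsetSum _ fun t _ => measurable_const.indicator (hf t)]
          refine Finset.sum_congr rfl fun t _ => ?_
          rw [lintegral_indicator_const (hf t)]
      _ ≤ _ := by
          refine lintegral_mono fun y => ?_
          simp only [Set.indicator_apply, Set.mem_preimage, Set.mem_singleton_iff]
          rw [Finset.sum_ite_eq]
          split_ifs <;> simp
  have h2 : ∑ t ∈ P, μ (f ⁻¹' {t}) = 1 := by
    rw [sum_measure_preimage_singleton P fun t _ => hf t]
    exact prob_compl_eq_zero_iff₀ (by
      rw [show f ⁻¹' (P : Set T) = ⋃ t ∈ P, f ⁻¹' {t} by ext; simp]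
      exact (P.measurableSet_biUnion fun t _ => hf t).nullMeasurableSet) |>.1 hfP
  have h3 : ∑ t ∈ P, μ.real (f ⁻¹' {t}) = 1 := by
    simp only [measureReal_def]
    rw [← ENNReal.toReal_sum fun t _ => measure_ne_top μ _, h2, ENNReal.toReal_one]
  have h4 := sq_sum_le_card_mul_sum_sq (s := P) (f := fun t => μ.real (f ⁻¹' {t}))
  refine le_trans ?_ h1
  have h5 : ∑ t ∈ P, μ (f ⁻¹' {t}) * μ (f ⁻¹' {t}) =
      ENNReal.ofReal (∑ t ∈ P, μ.real (f ⁻¹' {t}) ^ 2) := by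
    rw [ENNReal.ofReal_sum_of_nonneg fun t _ => sq_nonneg _]
    refine Finset.sum_congr rfl fun t _ => ?_
    rw [sq, ENNReal.ofReal_mul measureReal_nonneg, ofReal_measureReal]
  rw [h5]
  refine ENNReal.ofReal_le_ofReal ?_
  rw [h3, one_pow] at h4
  have h6 : (0 : ℝ) ≤ ∑ t ∈ P, μ.real (f ⁻¹' {t}) ^ 2 := Finset.sum_nonneg fun t _ => sq_nonneg _
  have h7 : (P.card : ℝ) ≤ k := by exact_mod_cast hP
  have hk : (0 : ℝ) < k := by
    by_contra h
    nlinarith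
  rw [div_le_iff₀ hk]
  nlinarith

/-! ### Simplices with `d - 1` fixed vertices -/

theorem exists_planar_projection {m n : ℕ} (hn : 1 ≤ n) (B : Fin n → Space (m + 2))
    (a : Fin (m + 1) → Space (m + 2))
    (ha : ∀ i, LinearIndependent ℝ (fun j => a j - B i)) :
    ∃ π : Space (m + 2) →ₗ[ℝ] ℝ × ℝ, Function.Surjective π ∧ (∀ j, π (a j - a 0) = 0) ∧
      ∀ i, π (B i - a 0) ≠ 0 := by
  set W := vectorSpan ℝ (Set.range a) with hW
  have hind : AffineIndependent ℝ a := by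
    rw [affineIndependent_iff]
    intro s w hw hwa
    refine linearIndependent_iff'.1 (ha ⟨0, hn⟩) s w ?_
    simp only [smul_sub, Finset.sum_sub_distrib, hwa, ← Finset.sum_smul, hw, zero_smul, sub_zero]
  have hWm : Module.finrank ℝ W = m := hind.finrank_vectorSpan (by simp)
  have hQ : Module.finrank ℝ (Space (m + 2) ⧸ W) = Module.finrank ℝ (ℝ × ℝ) := by
    have := W.finrank_quotient_add_finrank
    simp at this ⊢
    omega
  let e : (Space (m + 2) ⧸ W) ≃ₗ[ℝ] ℝ × ℝ := LinearEquiv.ofFinrankEq _ _ hQ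
  have hmem : ∀ j, a j - a 0 ∈ W := fun j =>
    vsub_mem_vectorSpan ℝ (Set.mem_range_self j) (Set.mem_range_self 0)
  refine ⟨e.toLinearMap ∘ₗ W.mkQ, e.surjective.comp W.mkQ_surjective, fun j => ?_, fun i hi => ?_⟩
  · have : W.mkQ (a j - a 0) = 0 := (Submodule.Quotient.mk_eq_zero W).2 (hmem j)
    simp only [LinearMap.comp_apply, this, map_zero]
  · have hB : B i - a 0 ∈ W :=
      (Submodule.Quotient.mk_eq_zero W).1 (e.map_eq_zero_iff.1 hi)
    have hle : Submodule.span ℝ (Set.range fun j => a j - B i) ≤ W := by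
      rw [Submodule.span_le]
      rintro _ ⟨j, rfl⟩
      have := W.sub_mem (hmem j) hB
      simpa using this
    have h1 := Submodule.finrank_mono hle
    rw [finrank_span_eq_card (ha i), hWm] at h1
    simp at h1

/-- The position of `x` relative to the hyperplanes spanned by the fibre of `π` through `a₀` and
the points `Bᵢ`. -/
def side {d n : ℕ} (π : Space d →ₗ[ℝ] ℝ × ℝ) (B : Fin n → Space d) (a₀ x : Space d) :
    Fin n → ℝ :=
  fun i => cross (π (B i - a₀)) (π (x - a₀))

theorem cross_add_right (b x y : ℝ × ℝ) : cross b (x + y) = cross b x + cross b y := by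
  simp only [cross, Prod.fst_add, Prod.snd_add]
  ring

theorem cross_smul_right (b x : ℝ × ℝ) (c : ℝ) : cross b (c • x) = c * cross b x := by
  simp only [cross, Prod.smul_fst, Prod.smul_snd, smul_eq_mul]
  ring

theorem cross_self (b : ℝ × ℝ) : cross b b = 0 := by
  simp only [cross]
  ring

/-- The planar cross product as a linear form in its second argument. -/
def crossLin (b : ℝ × ℝ) : ℝ × ℝ →ₗ[ℝ] ℝ where
  toFun := cross b
  map_add' := cross_add_right b
  map_smul' c x := cross_smul_right b x c

theorem continuous_side {d n : ℕ} (π : Space d →ₗ[ℝ] ℝ × ℝ) (B : Fin n → Space d)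
    (a₀ : Space d) (i : Fin n) : Continuous fun x => side π B a₀ x i :=
  ((crossLin (π (B i - a₀)) ∘ₗ π).continuous_of_finiteDimensional).comp
    (continuous_id.sub continuous_const)

theorem ae_side_ne_zero {d n : ℕ} (π : Space d →ₗ[ℝ] ℝ × ℝ) (hπ : Function.Surjective π)
    (B : Fin n → Space d) (a₀ : Space d) (hB : ∀ i, π (B i - a₀) ≠ 0) :
    ∀ᵐ x, ∀ i, side π B a₀ x i ≠ 0 := by
  refine ae_all_iff.2 fun i => ?_
  have hker : LinearMap.ker (crossLin (π (B i - a₀)) ∘ₗ π) ≠ ⊤ := by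
    intro h
    rw [LinearMap.ker_eq_top] at h
    obtain ⟨v, hv⟩ := hπ (-(π (B i - a₀)).2, (π (B i - a₀)).1)
    have h1 : cross (π (B i - a₀)) (π v) = 0 := LinearMap.congr_fun h v
    rw [hv] at h1
    simp only [cross] at h1
    have h2 : (π (B i - a₀)).1 = 0 ∧ (π (B i - a₀)).2 = 0 := by
      constructor <;> nlinarith [sq_nonneg (π (B i - a₀)).1, sq_nonneg (π (B i - a₀)).2]
    exact hB i (Prod.ext h2.1 h2.2)
  filter_upwards [ae_sub_notMem volume _ hker a₀] with x hx h
  exact hx h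

theorem notMem_convexHull_of_side {m n : ℕ} (B : Fin n → Space (m + 2))
    (a : Fin (m + 1) → Space (m + 2)) (ha : ∀ i, LinearIndependent ℝ (fun j => a j - B i))
    (π : Space (m + 2) →ₗ[ℝ] ℝ × ℝ) (hπa : ∀ j, π (a j - a 0) = 0) (x y : Space (m + 2))
    (i : Fin n) (hx : side π B (a 0) x i ≠ 0) (hy : side π B (a 0) y i ≠ 0)
    (hxy : 0 < side π B (a 0) x i ↔ 0 < side π B (a 0) y i) :
    B i ∉ convexHull ℝ (Set.range (Fin.cons x (Fin.cons y a : Fin (m + 2) → Space (m + 2)) :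
      Fin (m + 3) → Space (m + 2))) := by
  rw [mem_convexHull_range_iff]
  rintro ⟨w, ⟨hw0, hw1⟩, hw⟩
  rw [Fin.sum_univ_succ, Fin.sum_univ_succ] at hw hw1
  simp only [Fin.cons_zero, Fin.cons_succ] at hw
  set u := w 0
  set v := w (Fin.succ 0)
  have hB : B i - a 0 = u • (x - a 0) + (v • (y - a 0) +
      ∑ j : Fin (m + 1), w j.succ.succ • (a j - a 0)) := by
    simp only [smul_sub, Finset.sum_sub_distrib, ← Finset.sum_smul]
    have : ∑ j : Fin (m + 1), w j.succ.succ = 1 - u - v := by linarith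
    rw [this, ← hw]
    module
  -- Project the convex combination and take the cross product with the image of `B i`: that vector
  -- is parallel to itself, and the vertices `a j` project to the origin.
  have h0 : u * side π B (a 0) x i + v * side π B (a 0) y i = 0 := by
    have h := cross_self (π (B i - a 0))
    nth_rewrite 2 [hB] at h
    simp only [map_add, map_smul, map_sum, hπa, smul_zero, Finset.sum_const_zero, add_zero,
      cross_add_right, cross_smul_right] at h
    exact h
  have hu0 : 0 ≤ u := hw0 _
  have hv0 : 0 ≤ v := hw0 _
  have huv : u = 0 ∧ v = 0 := by
    rcases lt_or_gt_of_ne hx with h | h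
    · have h' : side π B (a 0) y i < 0 :=
        lt_of_le_of_ne (not_lt.1 fun h'' => h.not_gt (hxy.2 h'')) hy
      constructor <;> nlinarith
    · have h' := hxy.1 h
      constructor <;> nlinarith
  rw [huv.1, huv.2] at hw hw1
  simp only [zero_smul, zero_add] at hw hw1
  -- Without weight on `x` and `y`, `B i` is a convex combination of the `a j` alone, which
  -- contradicts independence.
  have hz : ∑ j : Fin (m + 1), w j.succ.succ • (a j - B i) = 0 := by
    simp only [smul_sub, Finset.sum_sub_distrib, ← Finset.sum_smul, hw1, one_smul, hw, sub_self]
  have hall := Fintype.linearIndependent_iff.1 (ha i) (fun j => w j.succ.succ) hz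
  simp [hall] at hw1

theorem one_div_le_lintegral_simplexSet {m n : ℕ} (hn : 1 ≤ n) (B : Fin n → Space (m + 2))
    (a : Fin (m + 1) → Space (m + 2)) (haC : ∀ j, a j ∈ openCube (m + 2))
    (ha : ∀ i, LinearIndependent ℝ (fun j => a j - B i)) :
    ENNReal.ofReal (1 / ((2 * n : ℕ) : ℝ)) ≤ ∫⁻ y, (volume.restrict (openCube (m + 2)))
      {x | (Fin.cons x (Fin.cons y a : Fin (m + 2) → Space (m + 2)) : Fin (m + 3) → Space (m + 2)) ∈
        simplexSet (m + 2) (openCube (m + 2) \ Set.range B)}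
        ∂volume.restrict (openCube (m + 2)) := by
  obtain ⟨π, hπ, hπa, hπB⟩ := exists_planar_projection hn B a ha
  obtain ⟨P, hPc, hP⟩ := exists_card_signPattern_le hn (fun i => π (B i - a 0)) hπB
  set f : Space (m + 2) → Fin n → Bool := fun x i => decide (0 < side π B (a 0) x i) with hf
  set μ := volume.restrict (openCube (m + 2)) with hμ
  have hne : ∀ᵐ x ∂μ, ∀ i, side π B (a 0) x i ≠ 0 :=
    ae_restrict_of_ae (ae_side_ne_zero π hπ B (a 0) hπB)
  have hmem : ∀ᵐ x ∂μ, x ∈ openCube (m + 2) :=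
    ae_restrict_mem (isOpen_openCube _).measurableSet
  have hmeas : ∀ t, MeasurableSet (f ⁻¹' {t}) := by
    intro t
    have : f ⁻¹' {t} = ⋂ i, {x | decide (0 < side π B (a 0) x i) = t i} := by
      ext x
      simp [hf, funext_iff]
    rw [this]
    refine MeasurableSet.iInter fun i => ?_
    have hpos : MeasurableSet {x | 0 < side π B (a 0) x i} :=
      (isOpen_lt continuous_const (continuous_side π B (a 0) i)).measurableSet
    cases t i
    · simpa [Set.compl_def] using hpos.compl
    · simpa using hpos
  refine (one_div_le_lintegral_measure_fiber μ f hmeas P hPc ?_).trans ?_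
  · filter_upwards [hne] with x hx
    exact hP (π (x - a 0)) hx
  · refine lintegral_mono_ae ?_
    filter_upwards [hne, hmem] with y hy hyC
    refine measure_mono_ae ?_
    filter_upwards [hne, hmem] with x hx hxC hxy
    change (Fin.cons x (Fin.cons y a : Fin (m + 2) → Space (m + 2)) :
      Fin (m + 3) → Space (m + 2)) ∈ simplexSet (m + 2) (openCube (m + 2) \ Set.range B)
    rw [simplexSet_openCube_diff]
    refine ⟨?_, ?_⟩
    · intro j _
      refine Fin.cases hxC (fun j => Fin.cases hyC (fun j => haC j) j) j
    · simp only [Set.mem_iUnion, Set.mem_ofPred_eq, not_exists]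
      intro i
      refine notMem_convexHull_of_side B a ha π hπa x y i (hx i) (hy i) ?_
      have h1 := congrFun (show f x = f y from hxy) i
      simpa [hf] using h1

theorem lintegral_pi_cons_cons {X : Type*} [MeasurableSpace X] (μ : Measure X) [SigmaFinite μ]
    {k : ℕ} {T : Set (Fin (k + 2) → X)} (hT : MeasurableSet T) :
    Measure.pi (fun _ => μ) T = ∫⁻ a, ∫⁻ y, μ {x | (Fin.cons x (Fin.cons y a : Fin (k + 1) → X) :
      Fin (k + 2) → X) ∈ T} ∂μ ∂Measure.pi (fun _ : Fin k => μ) := by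
  have hcons : ∀ k : ℕ, Measurable
      fun z : X × (Fin k → X) => (Fin.cons z.1 z.2 : Fin (k + 1) → X) := by
    intro k
    refine measurable_pi_lambda _ fun j => ?_
    refine Fin.cases ?_ (fun j => ?_) j
    · simpa using measurable_fst
    · exact (measurable_pi_apply j).comp measurable_snd
  have hmp : ∀ k : ℕ, MeasurePreserving
      (fun z : X × (Fin k → X) => (Fin.cons z.1 z.2 : Fin (k + 1) → X))
      (μ.prod (Measure.pi fun _ => μ)) (Measure.pi fun _ => μ) := by
    intro k
    have h := (measurePreserving_piFinSuccAbove (fun _ : Fin (k + 1) => μ) 0).symm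
    have he : (fun z : X × (Fin k → X) => (Fin.cons z.1 z.2 : Fin (k + 1) → X)) =
        (MeasurableEquiv.piFinSuccAbove (fun _ : Fin (k + 1) => X) 0).symm := by
      ext z : 1
      exact (Fin.insertNth_zero' _ _).symm
    rw [he]
    exact h
  have hT' := hcons (k + 1) hT
  rw [← (hmp (k + 1)).measure_preimage hT.nullMeasurableSet, Measure.prod_apply_symm hT']
  have hg : Measurable fun t : Fin (k + 1) → X =>
      μ ((fun x => (x, t)) ⁻¹' ((fun z : X × (Fin (k + 1) → X) =>
        (Fin.cons z.1 z.2 : Fin (k + 2) → X)) ⁻¹' T)) := measurable_measure_prodMk_right hT'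
  rw [← (hmp k).lintegral_comp hg, lintegral_prod_symm]
  · rfl
  · exact (hg.comp (hcons k)).aemeasurable

theorem one_div_le_volume_simplexSet {m n : ℕ} (hn : 1 ≤ n) (B : Fin n → Space (m + 2)) :
    ENNReal.ofReal (1 / ((2 * n : ℕ) : ℝ)) ≤
      volume (simplexSet (m + 2) (openCube (m + 2) \ Set.range B)) := by
  set T := simplexSet (m + 2) (openCube (m + 2) \ Set.range B) with hT
  set μ := volume.restrict (openCube (m + 2)) with hμ
  have hTm : MeasurableSet T := measurableSet_simplexSet_openCube_diff _ B
  have h1 : ∀ k, (volume : Measure (Fin k → Space (m + 2))).restrict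
      (Set.univ.pi fun _ => openCube (m + 2)) = Measure.pi fun _ => μ := fun k =>
    Measure.restrict_pi_pi (fun _ => volume) _
  have h2 : volume T = Measure.pi (fun _ => μ) T := by
    rw [← h1, Measure.restrict_eq_self _ (fun A hA j _ => (hA.1 j).1)]
  rw [h2, lintegral_pi_cons_cons μ hTm]
  calc ENNReal.ofReal (1 / ((2 * n : ℕ) : ℝ))
      = ∫⁻ _ : Fin (m + 1) → Space (m + 2), ENNReal.ofReal (1 / ((2 * n : ℕ) : ℝ))
          ∂Measure.pi (fun _ => μ) := by simp
    _ ≤ _ := by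
      refine lintegral_mono_ae ?_
      rw [← h1]
      have h3 : ∀ᵐ a : Fin (m + 1) → Space (m + 2),
          ∀ i, LinearIndependent ℝ (fun j => a j - B i) :=
        ae_all_iff.2 fun i => ae_linearIndependent_sub (B i) (m + 1) (by omega)
      filter_upwards [ae_restrict_of_ae h3, ae_restrict_mem
        (MeasurableSet.univ_pi fun _ => (isOpen_openCube (m + 2)).measurableSet)] with a ha haC
      exact one_div_le_lintegral_simplexSet hn B a (fun j => haC j trivial) ha

theorem one_div_le_kIndex {d n : ℕ} (hd : 2 ≤ d) (hn : 1 ≤ n) (B : Fin n → Space d) :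
    1 / (2 * (n : ℝ)) ≤ kIndex d (openCube d \ Set.range B) := by
  obtain ⟨m, rfl⟩ := Nat.exists_eq_add_of_le' hd
  have h := one_div_le_volume_simplexSet hn B
  have hfin : volume (simplexSet (m + 2) (openCube (m + 2) \ Set.range B)) ≠ ⊤ := by
    refine ((measure_mono (t := Set.univ.pi fun _ => openCube (m + 2))
      (fun A hA j _ => (hA.1 j).1)).trans_lt ?_).ne
    rw [volume_pi_pi]
    simp [volume_openCube]
  rw [kIndex, volume_openCube_diff (by omega) (Set.finite_range B), one_pow, div_one]
  rw [ENNReal.ofReal_le_iff_le_toReal hfin] at h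
  exact_mod_cast h

/-! ### Greedy hitting sets -/

/-- Greedy choice: the mean number of unhit sets containing a random point is at least `δ` times
their number, so some point hits that share and leaves at most a fraction `1 - δ`. -/
theorem exists_finset_card_unhit_le {X ι : Type*} [MeasurableSpace X] [DecidableEq X]
    (μ : Measure X) [IsProbabilityMeasure μ] (F : ι → Set X) (s : Finset ι) {δ : ℝ} (hδ : 0 < δ)
    (hδ1 : δ ≤ 1) (hF : ∀ i ∈ s, MeasurableSet (F i)) (hμ : ∀ i ∈ s, δ ≤ μ.real (F i)) (n : ℕ) :
    ∃ N : Finset X, N.card ≤ n ∧ (N : Set X) ⊆ ⋃ i ∈ s, F i ∧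
      ∃ u ⊆ s, (u.card : ℝ) ≤ (1 - δ) ^ n * s.card ∧
        ∀ i ∈ s, i ∉ u → ((N : Set X) ∩ F i).Nonempty := by
  classical
  induction n with
  | zero => exact ⟨∅, by simp, by simp, s, subset_rfl, by simp, fun i hi h => absurd hi h⟩
  | succ n ih =>
    obtain ⟨N, hNc, hNs, u, hus, huc, hu⟩ := ih
    have hint : ∀ i ∈ u, Integrable ((F i).indicator fun _ => (1 : ℝ)) μ := fun i hi =>
      (integrable_const 1).indicator (hF i (hus hi))
    obtain ⟨x, hx⟩ := exists_integral_le (μ := μ)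
      (f := fun x => ∑ i ∈ u, (F i).indicator (fun _ => (1 : ℝ)) x) (integrable_finsetSum _ hint)
    rw [integral_finsetSum _ hint] at hx
    have h1 : δ * u.card ≤ ∑ i ∈ u, ∫ x, (F i).indicator (fun _ => (1 : ℝ)) x ∂μ := by
      rw [mul_comm, ← nsmul_eq_mul]
      refine Finset.card_nsmul_le_sum _ _ _ fun i hi => ?_
      rw [integral_indicator_const _ (hF i (hus hi))]
      simpa using hμ i (hus hi)
    have h2 : ∑ i ∈ u, (F i).indicator (fun _ => (1 : ℝ)) x = (u.filter (x ∈ F ·)).card := by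
      simp [Set.indicator_apply]
    rw [h2] at hx
    have h3 : (u.filter (x ∉ F ·)).card + (u.filter (x ∈ F ·)).card = u.card := by
      rw [add_comm]
      exact Finset.card_filter_add_card_filter_not _
    have h3' : ((u.filter (x ∉ F ·)).card : ℝ) + (u.filter (x ∈ F ·)).card = u.card := by
      exact_mod_cast h3
    by_cases hne : u.Nonempty
    · have hpos : (0 : ℝ) < u.card := by exact_mod_cast hne.card_pos
      have hpos2 : (0 : ℝ) < (u.filter (x ∈ F ·)).card := by nlinarith
      obtain ⟨i, hi⟩ := Finset.card_pos.1 (by exact_mod_cast hpos2 :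
        0 < (u.filter (x ∈ F ·)).card)
      rw [Finset.mem_filter] at hi
      refine ⟨insert x N, (Finset.card_insert_le _ _).trans (by omega), ?_,
        u.filter (x ∉ F ·), (Finset.filter_subset _ _).trans hus, ?_, ?_⟩
      · rw [Finset.coe_insert, Set.insert_subset_iff]
        exact ⟨Set.mem_biUnion (hus hi.1) hi.2, hNs⟩
      · rw [pow_succ]
        nlinarith
      · intro j hj hju
        by_cases hjx : x ∈ F j
        · exact ⟨x, by simp, hjx⟩
        · have : j ∉ u := fun h => hju (Finset.mem_filter.2 ⟨h, hjx⟩)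
          obtain ⟨y, hy, hyj⟩ := hu j hj this
          exact ⟨y, by simp only [Finset.coe_insert]; exact Set.mem_insert_of_mem _ hy, hyj⟩
    · rw [Finset.not_nonempty_iff_eq_empty] at hne
      subst hne
      refine ⟨N, by omega, hNs, ∅, by simp, ?_, hu⟩
      have : (0 : ℝ) ≤ 1 - δ := by linarith
      simp
      positivity

theorem exists_finset_hitting {X ι : Type*} [MeasurableSpace X] (μ : Measure X)
    [IsProbabilityMeasure μ] (F : ι → Set X) (s : Finset ι) {δ : ℝ} (hδ : 0 < δ)
    (hF : ∀ i ∈ s, MeasurableSet (F i)) (hμ : ∀ i ∈ s, δ ≤ μ.real (F i)) :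
    ∃ N : Finset X, (N.card : ℝ) ≤ Real.log s.card / δ + 1 ∧ (N : Set X) ⊆ ⋃ i ∈ s, F i ∧
        ∀ i ∈ s, ((N : Set X) ∩ F i).Nonempty := by
  classical
  rcases s.eq_empty_or_nonempty with rfl | hs
  · exact ⟨∅, by simp, by simp, by simp⟩
  have hδ1 : δ ≤ 1 := by
    obtain ⟨i, hi⟩ := hs
    exact (hμ i hi).trans measureReal_le_one
  have hcard : (0 : ℝ) < s.card := by exact_mod_cast hs.card_pos
  have hlog : 0 ≤ Real.log s.card := Real.log_nonneg (by exact_mod_cast hs.card_pos)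
  obtain ⟨N, hNc, hNs, u, hus, huc, hu⟩ := exists_finset_card_unhit_le μ F s hδ hδ1 hF hμ
    -- The least integer above `log |s| / δ`: then `(1 - δ) ^ n * |s| ≤ exp (-δ n) * |s| < 1`, so no
    -- set remains unhit.
    (⌊Real.log s.card / δ⌋₊ + 1)
  refine ⟨N, ?_, hNs, ?_⟩
  · have h1 := Nat.floor_le (div_nonneg hlog hδ.le)
    have h2 : (N.card : ℝ) ≤ (⌊Real.log s.card / δ⌋₊ + 1 : ℕ) := by exact_mod_cast hNc
    push_cast at h2
    linarith
  · have h1 := Nat.lt_floor_add_one (Real.log s.card / δ)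
    rw [div_lt_iff₀ hδ] at h1
    set n := ⌊Real.log s.card / δ⌋₊ + 1 with hn
    have h2 : (1 - δ) ^ n ≤ Real.exp (-(δ * n)) := by
      rw [show -(δ * n) = n * (-δ) by ring, Real.exp_nat_mul]
      refine pow_le_pow_left₀ (by linarith) ?_ n
      have := Real.add_one_le_exp (-δ)
      linarith
    have h3 : Real.exp (-(δ * n)) * s.card < 1 := by
      nth_rewrite 1 [← Real.exp_log hcard]
      rw [← Real.exp_add, Real.exp_lt_one_iff]
      push_cast [hn]
      linarith
    have h4 : (u.card : ℝ) < 1 := by nlinarith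
    have h5 : u = ∅ := by
      rw [← Finset.card_eq_zero]
      have : u.card < 1 := by exact_mod_cast h4
      omega
    subst h5
    exact fun i hi => hu i hi (Finset.notMem_empty i)

/-! ### Large simplices in convex sets -/

/-- The matrix whose columns are the edges of the simplex `v` at its vertex `v 0`. -/
def edgeMatrix {d : ℕ} (v : Fin (d + 1) → Fin d → ℝ) : Matrix (Fin d) (Fin d) ℝ :=
  Matrix.of fun i j => v j.succ i - v 0 i

theorem edgeMatrix_mulVec {d : ℕ} (v : Fin (d + 1) → Fin d → ℝ) (t : Fin d → ℝ) :
    (edgeMatrix v).mulVec t = ∑ j, t j • (v j.succ - v 0) := by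
  ext i
  simp [edgeMatrix, Matrix.mulVec, dotProduct, mul_comm]

theorem add_edgeMatrix_mulVec_mem {d : ℕ} {K : Set (Fin d → ℝ)} (hK : Convex ℝ K)
    {v : Fin (d + 1) → Fin d → ℝ} (hv : ∀ i, v i ∈ K) {t : Fin d → ℝ} (ht : ∀ j, 0 ≤ t j)
    (ht1 : ∑ j, t j ≤ 1) : v 0 + (edgeMatrix v).mulVec t ∈ K := by
  have h := hK.sum_mem (t := Finset.univ) (w := (Fin.cons (1 - ∑ j, t j) t : Fin (d + 1) → ℝ))
    (z := v) (fun i _ => by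
      refine Fin.cases ?_ (fun j => ?_) i
      · simpa using ht1
      · simpa using ht j) (by simp [Fin.sum_univ_succ]) (fun i _ => hv i)
  convert! h using 1
  rw [edgeMatrix_mulVec, Fin.sum_univ_succ]
  simp only [Fin.cons_zero, Fin.cons_succ, smul_sub, Finset.sum_sub_distrib, ← Finset.sum_smul]
  module

theorem abs_det_le_factorial {d : ℕ} {A : Matrix (Fin d) (Fin d) ℝ} (hA : ∀ i j, |A i j| ≤ 1) :
    |A.det| ≤ d.factorial := by
  have := Matrix.det_le (abv := IsAbsoluteValue.toAbsoluteValue (abs : ℝ → ℝ)) (A := A) (x := 1) hA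
  simpa using this

theorem volume_add_mulVec_image {d : ℕ} (A : Matrix (Fin d) (Fin d) ℝ) (c : Fin d → ℝ)
    (s : Set (Fin d → ℝ)) :
    volume ((fun t => c + A.mulVec t) '' s) = ENNReal.ofReal |A.det| * volume s := by
  have h : (fun t => c + A.mulVec t) '' s = (fun x => c + x) '' (Matrix.toLin' A '' s) := by
    rw [Set.image_image]
    rfl
  rw [h, Set.image_add_left, measure_preimage_add, Measure.addHaar_image_linearMap,
    LinearMap.det_toLin']

/-- The open unit box in coordinate space. -/
def unitBox (d : ℕ) : Set (Fin d → ℝ) := Set.univ.pi fun _ => Set.Ioo 0 1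

theorem exists_edgeMatrix_det_ne_zero {d : ℕ} {K : Set (Fin d → ℝ)} (hK : Convex ℝ K)
    (hpos : 0 < volume K) : ∃ v : Fin (d + 1) → Fin d → ℝ, (∀ i, v i ∈ K) ∧
      (edgeMatrix v).det ≠ 0 := by
  have hint : (interior K).Nonempty := by
    by_contra h
    rw [Set.not_nonempty_iff_eq_empty] at h
    have h1 := hK.addHaar_frontier volume
    rw [frontier, h, Set.sdiff_empty] at h1
    exact hpos.ne' (measure_mono_null subset_closure h1)
  obtain ⟨x, hx⟩ := hint
  obtain ⟨r, hr, hrK⟩ := Metric.isOpen_iff.1 isOpen_interior x hx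
  refine ⟨Fin.cons x fun j => x + Pi.single j (r / 2), fun i => ?_, ?_⟩
  · refine Fin.cases (interior_subset hx) (fun j => interior_subset (hrK ?_)) i
    rw [Fin.cons_succ, Metric.mem_ball, dist_eq_norm, add_sub_cancel_left, Pi.norm_single,
      Real.norm_eq_abs, abs_of_pos (by positivity)]
    linarith
  · have : edgeMatrix (Fin.cons x fun j => x + Pi.single j (r / 2)) =
        Matrix.diagonal fun _ : Fin d => r / 2 := by
      ext i j
      simp only [edgeMatrix, Matrix.of_apply, Fin.cons_succ, Fin.cons_zero, Pi.add_apply,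
        add_sub_cancel_left, Matrix.diagonal_apply, Pi.single_apply]
    rw [this, Matrix.det_diagonal]
    simp [hr.ne']

theorem abs_sub_le_one {d : ℕ} {K : Set (Fin d → ℝ)} (hKQ : K ⊆ unitBox d) {x y : Fin d → ℝ}
    (hx : x ∈ K) (hy : y ∈ K) (i : Fin d) : |x i - y i| ≤ 1 := by
  have h1 := hKQ hx i trivial
  have h2 := hKQ hy i trivial
  rw [abs_le]
  constructor <;> linarith [h1.1, h1.2, h2.1, h2.2]

/-- Take a simplex in `K` with more than half the supremal determinant. By Cramer's rule every point
of `K` has coordinates in `[-2, 2]` with respect to its edges, so `K` lies in a parallelepiped of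
volume `4 ^ d` times the determinant. -/
theorem exists_edgeMatrix_det_ge {d : ℕ} {K : Set (Fin d → ℝ)} (hK : Convex ℝ K)
    (hKQ : K ⊆ unitBox d) {ε : ℝ} (hε : 0 < ε) (hvol : ENNReal.ofReal ε ≤ volume K) :
    ∃ v : Fin (d + 1) → Fin d → ℝ, (∀ i, v i ∈ K) ∧ ε / 4 ^ d ≤ |(edgeMatrix v).det| := by
  set Δ : Set ℝ := {r | ∃ v : Fin (d + 1) → Fin d → ℝ, (∀ i, v i ∈ K) ∧
    |(edgeMatrix v).det| = r} with hΔ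
  have hbdd : BddAbove Δ := by
    refine ⟨d.factorial, ?_⟩
    rintro _ ⟨v, hv, rfl⟩
    exact abs_det_le_factorial fun i j => abs_sub_le_one hKQ (hv _) (hv _) i
  obtain ⟨v₀, hv₀, hdet₀⟩ := exists_edgeMatrix_det_ne_zero hK
    ((ENNReal.ofReal_pos.2 hε).trans_le hvol)
  have hsup : 0 < sSup Δ := (abs_pos.2 hdet₀).trans_le (le_csSup hbdd ⟨v₀, hv₀, rfl⟩)
  obtain ⟨_, ⟨v, hv, rfl⟩, hvs⟩ := exists_lt_of_lt_csSup (s := Δ) ⟨_, v₀, hv₀, rfl⟩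
    (half_lt_self hsup)
  refine ⟨v, hv, ?_⟩
  set L := edgeMatrix v with hL
  have hLpos : 0 < |L.det| := by linarith
  have hLne : L.det ≠ 0 := abs_pos.1 hLpos
  have hsub : K ⊆ (fun t => v 0 + L.mulVec t) '' (Set.univ.pi fun _ => Set.Icc (-2) 2) := by
    intro x hx
    refine ⟨L.det⁻¹ • L.cramer (x - v 0), ?_, ?_⟩
    · intro j _
      -- The numerator in Cramer's rule is the determinant of the simplex with vertex `j.succ` moved
      -- to `x`, again a simplex in `K`.
      have hup : L.cramer (x - v 0) j = (edgeMatrix (Function.update v j.succ x)).det := by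
        rw [Matrix.cramer_apply]
        congr 1
        ext i k
        by_cases hjk : k = j
        · subst hjk
          simp [edgeMatrix, (Fin.succ_ne_zero k).symm]
        · simp [edgeMatrix, (Fin.succ_ne_zero j).symm, hjk, hL]
      have hle : |L.cramer (x - v 0) j| ≤ sSup Δ := by
        rw [hup]
        refine le_csSup hbdd ⟨_, fun i => ?_, rfl⟩
        by_cases hij : i = j.succ
        · subst hij
          simpa using hx
        · simpa [hij] using hv i
      rw [Set.mem_Icc, ← abs_le, Pi.smul_apply, smul_eq_mul, abs_mul, abs_inv,
        inv_mul_le_iff₀ hLpos]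
      linarith
    · simp only [Matrix.mulVec_smul, Matrix.mulVec_cramer, smul_smul, inv_mul_cancel₀ hLne,
        one_smul, add_sub_cancel]
  have h1 := hvol.trans (measure_mono hsub)
  rw [volume_add_mulVec_image, volume_pi_pi] at h1
  simp only [Real.volume_Icc, Finset.prod_const, Finset.card_univ, Fintype.card_fin] at h1
  rw [← ENNReal.ofReal_pow (by norm_num), ← ENNReal.ofReal_mul (abs_nonneg _),
    ENNReal.ofReal_le_ofReal_iff (by positivity)] at h1
  rw [div_le_iff₀ (by positivity)]
  norm_num at h1
  exact h1

theorem abs_cramer_le {d : ℕ} {L : Matrix (Fin d) (Fin d) ℝ} (hL : ∀ i j, |L i j| ≤ 1)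
    {e : Fin d → ℝ} {η : ℝ} (hη : 0 < η) (he : ∀ i, |e i| ≤ η) (j : Fin d) :
    |L.cramer e j| ≤ η * d.factorial := by
  have h1 : e = η • (η⁻¹ • e) := by rw [smul_smul, mul_inv_cancel₀ hη.ne', one_smul]
  rw [h1, map_smul, Pi.smul_apply, smul_eq_mul, abs_mul, abs_of_pos hη]
  refine mul_le_mul_of_nonneg_left ?_ hη.le
  rw [Matrix.cramer_apply]
  refine abs_det_le_factorial fun i k => ?_
  rw [Matrix.updateCol_apply]
  split_ifs
  · rw [Pi.smul_apply, smul_eq_mul, abs_mul, abs_inv, abs_of_pos hη, inv_mul_le_iff₀ hη, mul_one]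
    exact he i
  · exact hL i k

/-- Continuity of the determinant at `F = 0`, where it equals `(1 / 2) ^ d`. -/
theorem exists_det_perturbation {d : ℕ} (hd : 1 ≤ d) : ∃ κ : ℝ, 0 < κ ∧
    ∀ F : Matrix (Fin d) (Fin d) ℝ, (∀ i j, |F i j| ≤ κ) →
      (1 / 4) ^ d ≤ |(((1 / 2 : ℝ) • (1 : Matrix (Fin d) (Fin d) ℝ)) + F).det| := by
  let φ : (Fin d → Fin d → ℝ) → ℝ := fun F =>
    |(((1 / 2 : ℝ) • (1 : Matrix (Fin d) (Fin d) ℝ)) + Matrix.of F).det|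
  have hc : Continuous φ := by
    refine (Continuous.matrix_det ?_).abs
    exact continuous_const.add continuous_id
  have h0 : (1 / 4 : ℝ) ^ d < φ 0 := by
    have : φ 0 = (1 / 2) ^ d := by
      simp [φ]
    rw [this]
    exact pow_lt_pow_left₀ (by norm_num) (by norm_num) (by omega)
  obtain ⟨κ, hκ, h⟩ := Metric.eventually_nhds_iff.1 (hc.continuousAt.eventually_const_lt h0)
  refine ⟨κ / 2, by positivity, fun F hF => (h (y := fun i j => F i j) ?_).le⟩
  refine lt_of_le_of_lt ?_ (half_lt_self hκ)
  rw [dist_zero_right]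
  refine (pi_norm_le_iff_of_nonneg (by positivity)).2 fun i =>
    (pi_norm_le_iff_of_nonneg (by positivity)).2 fun j => hF i j

theorem edgeMatrix_add_mulVec {d : ℕ} (L : Matrix (Fin d) (Fin d) ℝ) (c : Fin d → ℝ)
    (w : Fin (d + 1) → Fin d → ℝ) :
    edgeMatrix (fun i => c + L.mulVec (w i)) = L * edgeMatrix w := by
  ext i j
  simp only [edgeMatrix, Matrix.of_apply, Matrix.mul_apply, Pi.add_apply, Matrix.mulVec,
    dotProduct, mul_sub, Finset.sum_sub_distrib]
  ring

theorem exists_grid_abs_sub_le {m : ℕ} (hm : 0 < m) {u : ℝ} (h0 : 0 < u) (h1 : u < 1) :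
    ∃ k : Fin (m + 1), |(k : ℝ) / m - u| ≤ 1 / m := by
  have hm' : (0 : ℝ) < m := by exact_mod_cast hm
  have h2 := Nat.floor_le (mul_pos h0 hm').le
  have h3 := Nat.lt_floor_add_one (u * m)
  refine ⟨⟨⌊u * m⌋₊, Nat.lt_succ_of_le (Nat.floor_le_of_le (by nlinarith))⟩, ?_⟩
  have h4 : (⌊u * m⌋₊ : ℝ) / m - u = (⌊u * m⌋₊ - u * m) / m := by
    field_simp
  simp only [h4, abs_div, abs_of_pos hm']
  refine div_le_div_of_nonneg_right ?_ hm'.le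
  rw [abs_le]
  constructor <;> linarith

/-- The grid point with coordinates `k / m`. -/
def gridPoint {d m : ℕ} (k : Fin d → Fin (m + 1)) : Fin d → ℝ := fun i => (k i : ℝ) / m

/-- Shrink the large simplex by half into its interior and round the vertices to the grid. In edge
coordinates the rounding error is at most `d! / (m |det L|)`, which is small once `m` is a large
multiple of `1 / ε`. -/
theorem exists_grid_simplex {d : ℕ} (hd : 1 ≤ d) : ∃ C : ℝ, 0 < C ∧
    ∀ (K : Set (Fin d → ℝ)) (ε : ℝ) (m : ℕ), Convex ℝ K → K ⊆ unitBox d → 0 < ε →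
      ENNReal.ofReal ε ≤ volume K → C / ε ≤ m →
      ∃ g : Fin (d + 1) → Fin d → Fin (m + 1), (∀ i, gridPoint (g i) ∈ K) ∧
        ε / 16 ^ d ≤ |(edgeMatrix fun i => gridPoint (g i)).det| := by
  obtain ⟨κ, hκ, hdet⟩ := exists_det_perturbation hd
  have hd' : (0 : ℝ) < d := by exact_mod_cast hd
  have hfac : (0 : ℝ) < d.factorial := by exact_mod_cast d.factorial_pos
  -- The bound `1 / (4 * d)` keeps the rounded vertices inside the simplex; `κ / 2` keeps
  -- differences of two errors within `κ`.
  set ρ := min (κ / 2) (1 / (4 * d)) with hρ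
  have hρ0 : 0 < ρ := by positivity
  refine ⟨d.factorial * 4 ^ d / ρ, by positivity, ?_⟩
  intro K ε m hK hKQ hε hvol hm
  have hm0 : (0 : ℝ) < m := lt_of_lt_of_le (by positivity) hm
  obtain ⟨v, hv, hvd⟩ := exists_edgeMatrix_det_ge hK hKQ hε hvol
  set L := edgeMatrix v with hL
  have hLpos : 0 < |L.det| := lt_of_lt_of_le (by positivity) hvd
  have hLne : L.det ≠ 0 := abs_pos.1 hLpos
  have hL1 : ∀ i j, |L i j| ≤ 1 := fun i j => abs_sub_le_one hKQ (hv _) (hv _) i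
  -- Edge coordinates of the shrunken simplex: every entry is at least `1 / (4 * d)` and the sum is
  -- at most `3 / 4`, leaving room `1 / (4 * d)` per coordinate.
  set τ : Fin (d + 1) → Fin d → ℝ := fun i k => 1 / (4 * d) + if i = k.succ then 1 / 2 else 0
    with hτ
  have hτ0 : ∀ i k, 1 / (4 * d) ≤ τ i k := by
    intro i k
    simp only [hτ]
    split_ifs <;> linarith
  have hτ1 : ∀ i, ∑ k, τ i k ≤ 3 / 4 := by
    intro i
    simp only [hτ, Finset.sum_add_distrib, Finset.sum_const, Finset.card_univ, Fintype.card_fin,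
      nsmul_eq_mul]
    have h1 : (d : ℝ) * (1 / (4 * d)) = 1 / 4 := by field_simp
    have h2 : ∑ k : Fin d, (if i = k.succ then (1 / 2 : ℝ) else 0) ≤ 1 / 2 := by
      refine Fin.cases ?_ (fun j => ?_) i
      · simp [(Fin.succ_ne_zero _).symm]
      · simp
    linarith
  have hu : ∀ i, v 0 + L.mulVec (τ i) ∈ K := fun i =>
    add_edgeMatrix_mulVec_mem hK hv (fun j => le_trans (by positivity) (hτ0 i j))
      (by linarith [hτ1 i])
  have hgrid : ∀ i j, ∃ k : Fin (m + 1), |(k : ℝ) / m - (v 0 + L.mulVec (τ i)) j| ≤ 1 / m :=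
    fun i j => exists_grid_abs_sub_le (by exact_mod_cast hm0) (hKQ (hu i) j trivial).1
      (hKQ (hu i) j trivial).2
  choose g hg using hgrid
  set f : Fin (d + 1) → Fin d → ℝ := fun i =>
    L.det⁻¹ • L.cramer (gridPoint (g i) - (v 0 + L.mulVec (τ i))) with hf
  have hfρ : ∀ i j, |f i j| ≤ ρ := by
    intro i j
    simp only [hf, Pi.smul_apply, smul_eq_mul, abs_mul, abs_inv]
    rw [inv_mul_le_iff₀ hLpos]
    have h1 := abs_cramer_le hL1 (e := gridPoint (g i) - (v 0 + L.mulVec (τ i)))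
      (η := 1 / m) (by positivity) (hg i) j
    refine h1.trans (le_trans ?_ (mul_le_mul_of_nonneg_right hvd hρ0.le))
    rw [div_div, div_le_iff₀ (by positivity)] at hm
    rw [one_div, inv_mul_le_iff₀ hm0]
    have h4 : (0 : ℝ) < 4 ^ d := by positivity
    rw [div_mul_eq_mul_div, mul_div_assoc', le_div_iff₀ h4]
    linarith
  have hpw : (fun i => gridPoint (g i)) = fun i => v 0 + L.mulVec (τ i + f i) := by
    ext i : 1
    simp only [hf, Matrix.mulVec_add, Matrix.mulVec_smul, Matrix.mulVec_cramer, smul_smul,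
      inv_mul_cancel₀ hLne, one_smul]
    abel
  refine ⟨g, fun i => ?_, ?_⟩
  · rw [show gridPoint (g i) = _ from congrFun hpw i]
    refine add_edgeMatrix_mulVec_mem hK hv (fun j => ?_) ?_
    · have h1 := abs_le.1 ((hfρ i j).trans (min_le_right _ _))
      have h2 := hτ0 i j
      simp only [Pi.add_apply]
      linarith [h1.1]
    · simp only [Pi.add_apply, Finset.sum_add_distrib]
      have h1 : ∑ j, f i j ≤ ∑ _j : Fin d, 1 / (4 * (d : ℝ)) := Finset.sum_le_sum fun j _ =>
        (abs_le.1 ((hfρ i j).trans (min_le_right _ _))).2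
      have h2 : ∑ _j : Fin d, 1 / (4 * (d : ℝ)) = 1 / 4 := by
        simp
        field_simp
      linarith [hτ1 i]
  · rw [hpw, edgeMatrix_add_mulVec, Matrix.det_mul, abs_mul]
    have h1 : edgeMatrix (fun i => τ i + f i) =
        (1 / 2 : ℝ) • (1 : Matrix (Fin d) (Fin d) ℝ) +
          Matrix.of fun k j => f j.succ k - f 0 k := by
      ext k j
      simp only [edgeMatrix, hτ, Matrix.of_apply, Pi.add_apply, Matrix.add_apply,
        Matrix.smul_apply, Matrix.one_apply, Fin.succ_inj, (Fin.succ_ne_zero _).symm, if_false,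
        smul_eq_mul, mul_ite, mul_one, mul_zero, eq_comm (a := j)]
      ring
    have h2 := hdet (Matrix.of fun k j => f j.succ k - f 0 k) fun k j => by
      have h3 := (hfρ j.succ k).trans (min_le_left _ _)
      have h4 := (hfρ 0 k).trans (min_le_left _ _)
      have h5 := abs_sub (f j.succ k) (f 0 k)
      simp only [Matrix.of_apply]
      linarith
    rw [h1]
    calc ε / 16 ^ d = ε / 4 ^ d * (1 / 4) ^ d := by
          rw [show (16 : ℝ) = 4 * 4 by norm_num, mul_pow, one_div, inv_pow]
          field_simp
      _ ≤ _ := mul_le_mul hvd h2 (by positivity) (abs_nonneg _)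

/-! ### Small nets for convex sets -/

/-- The parallelepiped cut off at the vertex `v 0` of the simplex `v`. -/
def cornerBox {d : ℕ} (v : Fin (d + 1) → Fin d → ℝ) : Set (Fin d → ℝ) :=
  (fun t => v 0 + (edgeMatrix v).mulVec t) '' Set.univ.pi fun _ => Set.Icc 0 (1 / (d : ℝ))

/-- Coordinates in `[0, 1 / d]` sum to at most 1. The box stands in for the simplex because its
volume follows at once from the determinant, at the cost of a factor depending only on `d`. -/
theorem cornerBox_subset {d : ℕ} (hd : 1 ≤ d) {K : Set (Fin d → ℝ)} (hK : Convex ℝ K)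
    {v : Fin (d + 1) → Fin d → ℝ} (hv : ∀ i, v i ∈ K) : cornerBox v ⊆ K := by
  rintro _ ⟨t, ht, rfl⟩
  refine add_edgeMatrix_mulVec_mem hK hv (fun j => (ht j trivial).1) ?_
  refine (Finset.sum_le_sum fun j _ => (ht j trivial).2).trans ?_
  have hd' : (0 : ℝ) < d := by exact_mod_cast hd
  simp
  field_simp
  exact le_rfl

theorem volume_cornerBox {d : ℕ} (v : Fin (d + 1) → Fin d → ℝ) :
    volume (cornerBox v) = ENNReal.ofReal (|(edgeMatrix v).det| / d ^ d) := by
  rw [cornerBox, volume_add_mulVec_image, volume_pi_pi]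
  simp only [Real.volume_Icc, Finset.prod_const, Finset.card_univ, Fintype.card_fin, sub_zero]
  rw [← ENNReal.ofReal_pow (by positivity), ← ENNReal.ofReal_mul (abs_nonneg _), one_div, inv_pow,
    div_eq_mul_inv]

theorem measurableSet_cornerBox {d : ℕ} (v : Fin (d + 1) → Fin d → ℝ) :
    MeasurableSet (cornerBox v) := by
  refine IsClosed.measurableSet (IsCompact.isClosed ?_)
  refine (isCompact_univ_pi fun _ => isCompact_Icc).image ?_
  exact continuous_const.add (Continuous.matrix_mulVec continuous_const continuous_id)

instance isProbabilityMeasure_restrict_unitBox (d : ℕ) :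
    IsProbabilityMeasure (volume.restrict (unitBox d)) :=
  ⟨by rw [Measure.restrict_apply_univ, unitBox, Real.volume_pi_Ioo]; simp⟩

theorem exists_convex_net_unitBox {d : ℕ} (hd : 1 ≤ d) : ∃ C : ℝ, 0 < C ∧
    ∀ ε : ℝ, 0 < ε → ε ≤ 1 → ∃ N : Finset (Fin d → ℝ),
      (N.card : ℝ) ≤ C / ε * max 1 (Real.logb 2 (1 / ε)) ∧ (N : Set (Fin d → ℝ)) ⊆ unitBox d ∧
      ∀ K, Convex ℝ K → K ⊆ unitBox d → ENNReal.ofReal ε ≤ volume K →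
        ((N : Set (Fin d → ℝ)) ∩ K).Nonempty := by
  classical
  obtain ⟨C, hC, hgrid⟩ := exists_grid_simplex hd
  have hd' : (0 : ℝ) < d := by exact_mod_cast hd
  -- The factors come from the count `(m + 1) ^ (d * (d + 1))` of grid tuples, from `log (m + 1)`,
  -- and from `ε / δ`; the final `+ 1` absorbs the extra point of the greedy bound.
  set D : ℝ := ((d + 1) * d) * (Real.log (C + 2) + 1) * (16 ^ d * d ^ d) + 1 with hD
  have hlogC : 0 ≤ Real.log (C + 2) := Real.log_nonneg (by linarith)
  refine ⟨D, by positivity, fun ε hε hε1 => ?_⟩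
  set m := ⌈C / ε⌉₊ with hm
  have hCm : C / ε ≤ m := Nat.le_ceil _
  set δ := ε / (16 ^ d * d ^ d) with hδ
  have hδ0 : 0 < δ := by positivity
  set F : (Fin (d + 1) → Fin d → Fin (m + 1)) → Set (Fin d → ℝ) :=
    fun g => cornerBox fun i => gridPoint (g i) with hF
  set s := Finset.univ.filter fun g => F g ⊆ unitBox d ∧ ENNReal.ofReal δ ≤ volume (F g) with hs
  obtain ⟨N, hNc, hNs, hN⟩ := exists_finset_hitting (volume.restrict (unitBox d)) F s hδ0
    (fun g _ => measurableSet_cornerBox _) (fun g hg => by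
      rw [hs, Finset.mem_filter] at hg
      rw [measureReal_def, Measure.restrict_eq_self _ hg.2.1]
      refine (ENNReal.ofReal_le_iff_le_toReal ?_).1 hg.2.2
      simp only [hF, volume_cornerBox]
      exact ENNReal.ofReal_ne_top)
  refine ⟨N, hNc.trans ?_, hNs.trans ?_, fun K hK hKQ hvol => ?_⟩
  · set M := max 1 (Real.logb 2 (1 / ε)) with hM
    have hM1 : 1 ≤ M := le_max_left _ _
    have hlogε : Real.log (1 / ε) ≤ M := by
      have h0 : 0 ≤ Real.log (1 / ε) := Real.log_nonneg (by rw [le_div_iff₀ hε]; linarith)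
      refine le_trans ?_ (le_max_right _ _)
      rw [Real.logb, le_div_iff₀ (Real.log_pos (by norm_num))]
      nlinarith [Real.log_two_lt_d9]
    have hlogs : Real.log s.card ≤ (d + 1) * d * ((Real.log (C + 2) + 1) * M) := by
      have h1 : s.card ≤ ((m + 1) ^ d) ^ (d + 1) := by
        refine (Finset.card_le_univ _).trans ?_
        simp
      have h2 : (m : ℝ) + 1 ≤ (C + 2) * (1 / ε) := by
        have := Nat.ceil_lt_add_one (a := C / ε) (by positivity)
        rw [mul_one_div, le_div_iff₀ hε]
        have h3 : C / ε * ε = C := div_mul_cancel₀ _ hε.ne'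
        nlinarith
      have h3 : Real.log ((m : ℝ) + 1) ≤ (Real.log (C + 2) + 1) * M := by
        refine (Real.log_le_log (by positivity) h2).trans ?_
        rw [Real.log_mul (by positivity) (by positivity)]
        nlinarith
      rcases Nat.eq_zero_or_pos s.card with h0 | h0
      · rw [h0]
        simp
        positivity
      · have h4 : (s.card : ℝ) ≤ (((m : ℝ) + 1) ^ d) ^ (d + 1) := by exact_mod_cast h1
        refine (Real.log_le_log (by exact_mod_cast h0) h4).trans ?_
        rw [Real.log_pow, Real.log_pow, ← mul_assoc]
        push_cast
        exact mul_le_mul_of_nonneg_left h3 (by positivity)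
    have h5 : Real.log s.card / δ ≤
        (d + 1) * d * ((Real.log (C + 2) + 1) * M) / δ := by gcongr
    have h6 : (d + 1) * d * ((Real.log (C + 2) + 1) * M) / δ = (D - 1) / ε * M := by
      rw [hδ, hD]
      field_simp
      ring
    have h7 : 1 ≤ 1 / ε * M := by
      have : 1 ≤ 1 / ε := by rw [le_div_iff₀ hε]; linarith
      nlinarith
    calc Real.log s.card / δ + 1 ≤ (D - 1) / ε * M + 1 / ε * M := by linarith
      _ = D / ε * M := by ring
  · refine Set.iUnion₂_subset fun g hg => ?_
    rw [hs, Finset.mem_filter] at hg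
    exact hg.2.1
  · obtain ⟨g, hgK, hg⟩ := hgrid K ε m hK hKQ hε hvol hCm
    have hsub : F g ⊆ K := cornerBox_subset hd hK hgK
    have hgs : g ∈ s := by
      rw [hs, Finset.mem_filter]
      refine ⟨Finset.mem_univ _, hsub.trans hKQ, ?_⟩
      simp only [hF, volume_cornerBox]
      refine ENNReal.ofReal_le_ofReal ?_
      rw [hδ, ← div_div]
      gcongr
    exact (hN g hgs).mono (Set.inter_subset_inter_right _ hsub)

theorem exists_convex_net {d : ℕ} (hd : 1 ≤ d) : ∃ C : ℝ, 0 < C ∧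
    ∀ ε : ℝ, 0 < ε → ε ≤ 1 → ∃ N : Finset (Space d),
      (N.card : ℝ) ≤ C / ε * max 1 (Real.logb 2 (1 / ε)) ∧ (N : Set (Space d)) ⊆ openCube d ∧
      ∀ K, Convex ℝ K → K ⊆ openCube d → ENNReal.ofReal ε ≤ volume K →
        ((N : Set (Space d)) ∩ K).Nonempty := by
  classical
  obtain ⟨C, hC, h⟩ := exists_convex_net_unitBox hd
  refine ⟨C, hC, fun ε hε hε1 => ?_⟩
  obtain ⟨N, hNc, hNQ, hN⟩ := h ε hε hε1
  refine ⟨N.image (WithLp.toLp 2), ?_, ?_, fun K hK hKQ hvol => ?_⟩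
  · have : ((N.image (WithLp.toLp 2)).card : ℝ) ≤ N.card := by
      exact_mod_cast Finset.card_image_le
    exact this.trans hNc
  · rw [Finset.coe_image]
    rintro _ ⟨x, hx, rfl⟩
    exact fun i => hNQ hx i trivial
  · have hvol' : volume (WithLp.toLp 2 ⁻¹' K : Set (Fin d → ℝ)) = volume K :=
      (EuclideanSpace.volume_preserving_symm_measurableEquiv_toLp (Fin d)).symm
        |>.measure_preimage_equiv K
    obtain ⟨x, hxN, hxK⟩ := hN (WithLp.toLp 2 ⁻¹' K)
      (hK.linear_preimage (WithLp.linearEquiv 2 ℝ (Fin d → ℝ)).symm.toLinearMap)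
      (fun x hx i _ => hKQ hx i) (hvol'.symm ▸ hvol)
    exact ⟨WithLp.toLp 2 x, by simpa using hxN, hxK⟩

/-! ### The convexity ratio -/

theorem supConvex_le_of_hits {d : ℕ} {ε : ℝ} {N : Set (Space d)}
    (hN : ∀ K, Convex ℝ K → K ⊆ openCube d → ENNReal.ofReal ε ≤ volume K → (N ∩ K).Nonempty) :
    supConvex (openCube d \ N) ≤ ENNReal.ofReal ε := by
  refine sSup_le ?_
  rintro _ ⟨K, hKS, hK, rfl⟩
  by_contra h
  obtain ⟨x, hxN, hxK⟩ := hN K hK (hKS.trans Set.sdiff_subset) (not_le.1 h).le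
  exact (hKS hxK).2 hxN

theorem supConvex_pos {d : ℕ} {S : Set (Space d)} (hS : IsOpen S) (hne : S.Nonempty) :
    0 < supConvex S := by
  obtain ⟨x, hx⟩ := hne
  obtain ⟨r, hr, hrS⟩ := Metric.isOpen_iff.1 hS x hx
  exact (Metric.measure_ball_pos volume x hr).trans_le
    (le_sSup ⟨Metric.ball x r, hrS, convex_ball x r, rfl⟩)

theorem convex_of_isEllipsoid {d : ℕ} {E : Set (Space d)} (hE : IsEllipsoid E) : Convex ℝ E := by
  obtain ⟨f, rfl⟩ := hE
  exact (convex_closedBall 0 1).affine_image f.toAffineMap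

/-- The ratio `c(S)` may lie well below the net level; monotonicity of `x / log₂ (1 / x)` reduces
the bound in terms of `c(S)` to the one at that level. -/
theorem div_logb_inv_le_div_logb_inv {x y : ℝ} (hx : 0 < x) (hxy : x ≤ y) (hy : y < 1) :
    x / Real.logb 2 (1 / x) ≤ y / Real.logb 2 (1 / y) := by
  have hy0 : 0 < y := hx.trans_le hxy
  have h1 : 0 < Real.logb 2 (1 / y) :=
    Real.logb_pos (by norm_num) (by rw [lt_div_iff₀ hy0]; linarith)
  have h2 : Real.logb 2 (1 / y) ≤ Real.logb 2 (1 / x) :=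
    Real.logb_le_logb_of_le (by norm_num) (by positivity) (one_div_le_one_div_of_le hx hxy)
  exact div_le_div₀ hy0.le hxy h1 h2

end ConvexityIndex

/-! ### The theorem: the cube minus a net of level `ε / d ^ d` -/

theorem mainTheorem3 (d : ℕ) (hd : 2 ≤ d) :
    (∃ γ : ℝ, 0 < γ ∧ ∀ ε : ℝ, 0 < ε → ε ≤ 1 →
      ∃ (S N : Set (ConvexityIndex.Space d)),
        N.Finite ∧
        ConvexityIndex.IsNet (ε / (d : ℝ) ^ d) (ConvexityIndex.openCube d)
          (ConvexityIndex.ellipsoidsIn (ConvexityIndex.openCube d)) N ∧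
        S = ConvexityIndex.openCube d \ N ∧
        MeasureTheory.volume S = 1 ∧
        ConvexityIndex.KIndexDefined d S ∧
        ConvexityIndex.convexityRatio S ≤ ε ∧
        γ * (ε / max 1 (Real.logb 2 (1 / ε))) ≤ ConvexityIndex.kIndex d S ∧
        0 < ConvexityIndex.convexityRatio S ∧
        ConvexityIndex.convexityRatio S < 1 ∧
        γ * (ConvexityIndex.convexityRatio S /
            Real.logb 2 (1 / ConvexityIndex.convexityRatio S)) ≤
          ConvexityIndex.kIndex d S) ∧
    (∀ (n : ℕ), 1 ≤ n → ∀ B : Fin n → ConvexityIndex.Space d,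
      (∀ i, B i ∈ ConvexityIndex.openCube d) →
        ConvexityIndex.KIndexDefined d (ConvexityIndex.openCube d \ Set.range B) ∧
        1 / (2 * (n : ℝ)) ≤
          ConvexityIndex.kIndex d (ConvexityIndex.openCube d \ Set.range B)) := by
  open ConvexityIndex in
  refine ⟨?_, fun n hn B _ =>
    ⟨kIndexDefined_openCube_diff (by omega) d B, one_div_le_kIndex hd hn B⟩⟩
  obtain ⟨C, hC, hnet⟩ := exists_convex_net (d := d) (by omega)
  have hd2 : (2 : ℝ) ≤ d := by exact_mod_cast hd
  have hdd : (2 : ℝ) ≤ (d : ℝ) ^ d := hd2.trans (le_self_pow₀ (by linarith) (by omega))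
  set T : ℝ := (d : ℝ) ^ d with hT
  have hT0 : 0 < T := by linarith
  have hlogT : 1 ≤ Real.logb 2 T := by
    rw [Real.le_logb_iff_rpow_le (by norm_num) hT0]
    simpa using hdd
  -- The net at level `ε / T` has at most `C * T * (1 + log₂ T) * M / ε` points, where `M` is the
  -- maximum in the statement; part (2) contributes the factor 2.
  refine ⟨1 / (2 * C * T * (1 + Real.logb 2 T)), by positivity, fun ε hε hε1 => ?_⟩
  set ε' := ε / T with hε'
  have hε'0 : 0 < ε' := by positivity
  have hε'1 : ε' < 1 := by
    rw [hε', div_lt_one hT0]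
    linarith
  have hε'ε : ε' ≤ ε := div_le_self hε.le (by linarith)
  obtain ⟨N, hNc, hNQ, hN⟩ := hnet ε' hε'0 hε'1.le
  have hlog : Real.logb 2 (1 / ε') = Real.logb 2 T + Real.logb 2 (1 / ε) := by
    rw [← Real.logb_mul hT0.ne' (by positivity), hε']
    congr 1
    field_simp
  have hlogε : 0 ≤ Real.logb 2 (1 / ε) :=
    Real.logb_nonneg (by norm_num) (by rw [le_div_iff₀ hε]; linarith)
  set M := max 1 (Real.logb 2 (1 / ε)) with hM
  have hM1 : 1 ≤ M := le_max_left _ _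
  have hM2 : Real.logb 2 (1 / ε) ≤ M := le_max_right _ _
  -- Since `T ≥ 2`, passing from `ε` to `ε / T` raises the logarithm by at least 1, so the maximum
  -- with 1 is dominated even for `ε` near 1.
  have hMlog : M ≤ Real.logb 2 (1 / ε') := by
    rw [hlog]
    exact max_le (by linarith) (by linarith)
  have hNne : 1 ≤ N.card := by
    obtain ⟨x, hx, _⟩ := hN (openCube d) (convex_openCube d) subset_rfl (by
      rw [volume_openCube, ← ENNReal.ofReal_one]
      exact ENNReal.ofReal_le_ofReal hε'1.le)
    exact Finset.card_pos.2 ⟨x, hx⟩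
  have hNM : (N.card : ℝ) ≤ C * T * (1 + Real.logb 2 T) * M / ε := by
    have h1 : max 1 (Real.logb 2 (1 / ε')) ≤ (1 + Real.logb 2 T) * M := by
      rw [hlog]
      exact max_le (by nlinarith) (by nlinarith)
    calc (N.card : ℝ) ≤ C / ε' * max 1 (Real.logb 2 (1 / ε')) := hNc
      _ ≤ C / ε' * ((1 + Real.logb 2 T) * M) := by gcongr
      _ = _ := by
        rw [hε']
        field_simp
  obtain ⟨B, hB⟩ : ∃ B : Fin N.card → Space d, Set.range B = (N : Set (Space d)) :=
    ⟨fun i => N.equivFin.symm i, by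
      rw [Set.range_comp' Subtype.val, N.equivFin.symm.surjective.range_eq]
      simp⟩
  have hdef := kIndexDefined_openCube_diff (by omega : 1 ≤ d) d B
  have hidx := one_div_le_kIndex hd hNne B
  rw [hB] at hdef hidx
  have hvol := volume_openCube_diff (by omega : 1 ≤ d) N.finite_toSet
  have hkey : 1 / (2 * C * T * (1 + Real.logb 2 T)) * (ε / M) ≤
      kIndex d (openCube d \ (N : Set (Space d))) := by
    refine le_trans ?_ hidx
    have hc0 : (0 : ℝ) < N.card := by exact_mod_cast hNne
    rw [le_div_iff₀ hε] at hNM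
    rw [one_div_mul_eq_div, div_div, div_le_div_iff₀ (by positivity) (by positivity)]
    linarith
  have hsup := supConvex_le_of_hits hN
  have hsup_ne : supConvex (openCube d \ (N : Set (Space d))) ≠ ⊤ :=
    (hsup.trans_lt ENNReal.ofReal_lt_top).ne
  have hratio : convexityRatio (openCube d \ (N : Set (Space d))) =
      (supConvex (openCube d \ (N : Set (Space d)))).toReal := by
    rw [convexityRatio, hvol, div_one]
  have hle : convexityRatio (openCube d \ (N : Set (Space d))) ≤ ε' := by
    rw [hratio]
    exact ENNReal.toReal_le_of_le_ofReal hε'0.le hsup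
  have hpos : 0 < convexityRatio (openCube d \ (N : Set (Space d))) := by
    rw [hratio]
    refine ENNReal.toReal_pos (supConvex_pos ?_ ?_).ne' hsup_ne
    · exact (isOpen_openCube d).sdiff N.finite_toSet.isClosed
    · exact nonempty_of_measure_ne_zero (μ := MeasureTheory.volume) (by rw [hvol]; exact one_ne_zero)
  refine ⟨openCube d \ (N : Set (Space d)), N, N.finite_toSet, ⟨hNQ, ?_⟩, rfl, hvol, hdef,
    hle.trans hε'ε, hkey, hpos, hle.trans_lt hε'1, le_trans ?_ hkey⟩
  · rintro _ ⟨E, hE, rfl⟩ hU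
    exact hN _ ((convex_of_isEllipsoid hE).inter (convex_openCube d)) Set.inter_subset_right hU
  -- With `c = c(S) ≤ ε'`: `c / log₂ (1 / c) ≤ ε' / log₂ (1 / ε') ≤ ε / M`, so the same constant
  -- serves.
  · refine mul_le_mul_of_nonneg_left ?_ (by positivity)
    refine (div_logb_inv_le_div_logb_inv hpos hle hε'1).trans ?_
    exact div_le_div₀ hε.le hε'ε (by linarith) hMlog

end
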